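/- Let $\Omega\subset\mathbb R^3$ be a bounded Lipschitz domain and let $B\subset\Omega$ be a Lipschitz domain (domains are non-empty, open and connected). Fix $L\ge 0$ and $\delta>0$, and let $\mathcal O$ be the set of all open sets $\omega\subset B$ (the empty set being admitted) that are Lipschitz with uniform Lipschitz constant $L$ on neighbourhoods of the uniform radius $\delta$: for every $x_0\in\partial\omega$ there are orthonormal coordinates centred at $x_0$ and a Lipschitz function $g:\mathbb R^2\to\mathbb R$ with constant $L$ such that, for every point with coordinates $y\in\mathbb R^3$, $|y|<\delta$, the point lies in $\omega$ if and only if $y_3>g(y_1,y_2)$. Let $C^1(B)$ denote the space of continuously differentiable functions on $B$ with finite $C^1$-norm. Let $E_d\in C^1(B)^3$; let $\kappa\in C^1(B)$ with $\kappa>0$ on $B$; let $j_c>0$; let $f\in L^2(\Omega)^3\cap C^1(B)^3$; and let $\varepsilon,\nu\in L^\infty(\Omega,\mathbb R^{3\times 3})\cap C^1(B,\mathbb R^{3\times 3})$ be symmetric and uniformly positive definite, i.e. there are $\underline\varepsilon,\underline\nu>0$ with $\xi^{\mathsf T}\varepsilon(x)\xi\ge\underline\varepsilon|\xi|^2$ and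 $\xi^{\mathsf T}\nu(x)\xi\ge\underline\nu|\xi|^2$ for a.e. $x\in\Omega$ and all $\xi\in\mathbb R^3$. Let $H(\mathrm{curl})=\{v\in L^2(\Omega)^3:\operatorname{curl}v\in L^2(\Omega)^3\}$ (distributional curl) with norm $(\|v\|_{L^2}^2+\|\operatorname{curl}v\|_{L^2}^2)^{1/2}$, and let $H_0(\mathrm{curl})$ be the closure of $C_0^\infty(\Omega)^3$ in $H(\mathrm{curl})$. Put $$a(v,w)=\int_\Omega \nu\operatorname{curl}v\cdot\operatorname{curl}w\,dx+\int_\Omega\varepsilon v\cdot w\,dx,\qquad \varphi_\omega(v)=j_c\int_\omega|v|\,dx .$$ Then for every $\omega\in\mathcal O$ there is a unique $E(\omega)\in H_0(\mathrm{curl})$ such that $$a(E(\omega),v-E(\omega))+\varphi_\omega(v)-\varphi_\omega(E(\omega))\ \ge\ \int_\Omega f\cdot(v-E(\omega))\,dx\qquad\text{for all }v\in H_0(\mathrm{curl}),$$ and the shape optimization problem $$\min_{\omega\in\mathcal O}J(\omega),\qquad J(\omega)=\frac12\int_B\kappa\,|E(\omega)-E_d|^2\,dx+\int_\omega dx,$$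 has an optimal solution: there is $\omega_\star\in\mathcal O$ with $J(\omega_\star)\le J(\omega)$ for all $\omega\in\mathcal O$. -/

import Mathlib

open MeasureTheory
open scoped NNReal ENNReal

namespace ShapeOpt

noncomputable section

/-- Euclidean three-space. -/
abbrev E3 := EuclideanSpace ℝ (Fin 3)

/-! ### Lipschitz sets -/

/-- Inside the ball of radius `δ` around `x₀`, and in suitable orthonormal coordinates centred at
`x₀`, the set `U` is the open epigraph of an `L`-Lipschitz function of the first two coordinates. -/
def IsLipschitzGraphNear (U : Set E3) (L : ℝ≥0) (δ : ℝ) (x₀ : E3) : Prop :=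
  ∃ (R : E3 ≃ₗᵢ[ℝ] E3) (g : EuclideanSpace ℝ (Fin 2) → ℝ), LipschitzWith L g ∧
    ∀ y : E3, ‖y‖ < δ → (x₀ + R y ∈ U ↔ g !₂[y 0, y 1] < y 2)

/-- A Lipschitz domain: non-empty, open, connected, with a boundary that is locally the graph of a
Lipschitz function (the Lipschitz constant and the radius may depend on the boundary point). -/
structure IsLipschitzDomain (U : Set E3) : Prop where
  isOpen : IsOpen U
  isConnected : IsConnected U
  lipschitz : ∀ x₀ ∈ frontier U, ∃ (L : ℝ≥0) (δ : ℝ), 0 < δ ∧ IsLipschitzGraphNear U L δ x₀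

/-- The admissible shapes: the open subsets of `B` that are Lipschitz with the uniform Lipschitz
constant `L` (on boundary neighbourhoods of the uniform radius `δ`). -/
def admissibleShapes (B : Set E3) (L : ℝ≥0) (δ : ℝ) : Set (Set E3) :=
  {s | s ⊆ B ∧ IsOpen s ∧ ∀ x₀ ∈ frontier s, IsLipschitzGraphNear s L δ x₀}

/-! ### Function spaces -/

/-- The Banach space `C¹(B)`, for open `B`: continuously differentiable functions on `B` with
finite `C¹`-norm. -/
def MemC1 {F : Type*} [NormedAddCommGroup F] [NormedSpace ℝ F] (B : Set E3) (g : E3 → F) : Prop :=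
  ContDiffOn ℝ 1 g B ∧ ∃ C : ℝ, ∀ x ∈ B, ‖g x‖ ≤ C ∧ ‖fderiv ℝ g x‖ ≤ C

/-- Real square-integrable vector fields on `Ω`. -/
abbrev L2 (Ω : Set E3) := Lp E3 2 (volume.restrict Ω)

/-- The partial derivative `∂ⱼ φᵢ` at `x`. -/
def partialDeriv (φ : E3 → E3) (j i : Fin 3) (x : E3) : ℝ :=
  fderiv ℝ φ x (EuclideanSpace.single j 1) i

/-- The classical curl of a differentiable vector field. -/
def classicalCurl (φ : E3 → E3) (x : E3) : E3 :=
  !₂[partialDeriv φ 1 2 x - partialDeriv φ 2 1 x,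
     partialDeriv φ 2 0 x - partialDeriv φ 0 2 x,
     partialDeriv φ 0 1 x - partialDeriv φ 1 0 x]

/-- Smooth vector fields with compact support in `Ω`. -/
structure IsTestField (Ω : Set E3) (φ : E3 → E3) : Prop where
  contDiff : ContDiff ℝ ((⊤ : ℕ∞) : WithTop ℕ∞) φ
  hasCompactSupport : HasCompactSupport φ
  tsupport_subset : tsupport φ ⊆ Ω

theorem IsTestField.memLp {Ω : Set E3} {φ : E3 → E3} (h : IsTestField Ω φ) :
    MemLp φ 2 (volume.restrict Ω) :=
  (h.contDiff.continuous.memLp_of_hasCompactSupport h.hasCompactSupport).restrict Ω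

theorem IsTestField.curl_memLp {Ω : Set E3} {φ : E3 → E3} (h : IsTestField Ω φ) :
    MemLp (classicalCurl φ) 2 (volume.restrict Ω) := by
  refine (Continuous.memLp_of_hasCompactSupport ?_ ?_).restrict Ω
  · have hf : Continuous (fderiv ℝ φ) := h.contDiff.continuous_fderiv (by simp)
    have hp : ∀ j i, Continuous (partialDeriv φ j i) := fun j i => by
      unfold partialDeriv
      fun_prop
    unfold classicalCurl
    refine (PiLp.continuous_toLp 2 _).comp (continuous_pi fun i => ?_)
    fin_cases i
    · exact (hp 1 2).sub (hp 2 1)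
    · exact (hp 2 0).sub (hp 0 2)
    · exact (hp 0 1).sub (hp 1 0)
  · refine (h.hasCompactSupport.fderiv ℝ).mono ?_
    intro x hx
    contrapose! hx
    have h0 : fderiv ℝ φ x = 0 := by simpa using hx
    simp only [Function.mem_support, not_not]
    ext i
    fin_cases i <;> simp [classicalCurl, partialDeriv, h0]

theorem IsTestField.add {Ω : Set E3} {φ ψ : E3 → E3} (h : IsTestField Ω φ)
    (h' : IsTestField Ω ψ) : IsTestField Ω (φ + ψ) where
  contDiff := h.contDiff.add h'.contDiff
  hasCompactSupport := h.hasCompactSupport.add h'.hasCompactSupport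
  tsupport_subset := (tsupport_add φ ψ).trans
    (Set.union_subset h.tsupport_subset h'.tsupport_subset)

theorem IsTestField.const_smul {Ω : Set E3} {φ : E3 → E3} (c : ℝ) (h : IsTestField Ω φ) :
    IsTestField Ω (c • φ) where
  contDiff := h.contDiff.const_smul c
  hasCompactSupport := h.hasCompactSupport.mono (Function.support_const_smul_subset c φ)
  tsupport_subset :=
    (closure_mono (Function.support_const_smul_subset c φ)).trans h.tsupport_subset

theorem IsTestField.zero (Ω : Set E3) : IsTestField Ω 0 where
  contDiff := contDiff_const
  hasCompactSupport := HasCompactSupport.zero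
  tsupport_subset := by simp

/-- The space `H(curl)` on `Ω`. A vector field `v` in `L²` with distributional curl `w` in `L²` is
represented by the pair `(v, w)` (the second entry is determined by the first one when `Ω` is
open), and the norm is the graph norm `(‖v‖² + ‖curl v‖²)^(1/2)`. -/
def HCurl (Ω : Set E3) : Submodule ℝ (WithLp 2 (L2 Ω × L2 Ω)) where
  carrier := {u | ∀ φ : E3 → E3, IsTestField Ω φ →
    ∫ x in Ω, inner ℝ (u.fst x) (classicalCurl φ x) = ∫ x in Ω, inner ℝ (u.snd x) (φ x)}
  zero_mem' := by
    intro φ _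
    have h : ∀ ψ : E3 → E3, ∫ x in Ω, inner ℝ ((0 : L2 Ω) x) (ψ x) = 0 := fun ψ => by
      refine integral_eq_zero_of_ae ?_
      filter_upwards [Lp.coeFn_zero E3 2 (volume.restrict Ω)] with x hx
      rw [hx]
      simp
    exact (h _).trans (h _).symm
  add_mem' := by
    intro u v hu hv φ hφ
    have hi : ∀ (a : L2 Ω) (ψ : E3 → E3), MemLp ψ 2 (volume.restrict Ω) →
        Integrable (fun x => inner ℝ (a x) (ψ x)) (volume.restrict Ω) := by
      intro a ψ hψ
      refine (L2.integrable_inner (𝕜 := ℝ) a hψ.toLp).congr ?_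
      filter_upwards [hψ.coeFn_toLp] with x hx
      rw [hx]
    have h : ∀ (a b : L2 Ω) (ψ : E3 → E3), MemLp ψ 2 (volume.restrict Ω) →
        ∫ x in Ω, inner ℝ ((a + b : L2 Ω) x) (ψ x)
          = (∫ x in Ω, inner ℝ (a x) (ψ x)) + ∫ x in Ω, inner ℝ (b x) (ψ x) := by
      intro a b ψ hψ
      rw [← integral_add (hi a ψ hψ) (hi b ψ hψ)]
      refine integral_congr_ae ?_
      filter_upwards [Lp.coeFn_add a b] with x hx
      rw [hx]
      exact inner_add_left _ _ _
    have h1 := h u.fst v.fst _ hφ.curl_memLp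
    have h2 := h u.snd v.snd _ hφ.memLp
    exact h1.trans ((congrArg₂ (· + ·) (hu φ hφ) (hv φ hφ)).trans h2.symm)
  smul_mem' := by
    intro c u hu φ hφ
    have h : ∀ (a : L2 Ω) (ψ : E3 → E3),
        ∫ x in Ω, inner ℝ ((c • a : L2 Ω) x) (ψ x) = c * ∫ x in Ω, inner ℝ (a x) (ψ x) := by
      intro a ψ
      rw [← integral_const_mul]
      refine integral_congr_ae ?_
      filter_upwards [Lp.coeFn_smul c a] with x hx
      simp [hx, inner_smul_left]
    exact (h u.fst _).trans ((congrArg (c * ·) (hu φ hφ)).trans (h u.snd _).symm)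

/-- The vector field underlying an element of `H(curl)`. -/
def vecField {Ω : Set E3} (u : HCurl Ω) : L2 Ω := (u : WithLp 2 (L2 Ω × L2 Ω)).fst

/-- The distributional curl of an element of `H(curl)`. -/
def curlField {Ω : Set E3} (u : HCurl Ω) : L2 Ω := (u : WithLp 2 (L2 Ω × L2 Ω)).snd

/-- The elements of `H(curl)` given by smooth vector fields with compact support in `Ω`. -/
def testFields (Ω : Set E3) : Submodule ℝ (HCurl Ω) where
  carrier := {u | ∃ φ : E3 → E3, IsTestField Ω φ ∧ vecField u =ᵐ[volume.restrict Ω] φ}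
  zero_mem' := ⟨0, IsTestField.zero Ω, Lp.coeFn_zero E3 2 (volume.restrict Ω)⟩
  add_mem' := by
    rintro u v ⟨φ, hφ, hu⟩ ⟨ψ, hψ, hv⟩
    exact ⟨φ + ψ, hφ.add hψ, (Lp.coeFn_add (vecField u) (vecField v)).trans (hu.add hv)⟩
  smul_mem' := by
    rintro c u ⟨φ, hφ, hu⟩
    exact ⟨c • φ, hφ.const_smul c, (Lp.coeFn_smul c (vecField u)).trans (hu.const_smul c)⟩

/-- `H₀(curl)`: the closure of the compactly supported smooth fields in the `H(curl)`-norm. -/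
def H0Curl (Ω : Set E3) : Submodule ℝ (HCurl Ω) := (testFields Ω).topologicalClosure

/-! ### The variational inequality and the cost functional -/

/-- Matrix-valued coefficients in `L^∞(Ω)` that are continuously differentiable on `B`, symmetric
and uniformly positive definite on `Ω`. -/
structure IsMaterialParameter (Ω B : Set E3) (A : E3 → Matrix (Fin 3) (Fin 3) ℝ) : Prop where
  memLp_top : ∀ i j, MemLp (fun x => A x i j) ∞ (volume.restrict Ω)
  memC1 : ∀ i j, MemC1 B (fun x => A x i j)
  symm : ∀ᵐ x ∂(volume.restrict Ω), (A x).IsSymm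
  posDef : ∃ c : ℝ, 0 < c ∧ ∀ᵐ x ∂(volume.restrict Ω), ∀ ξ : E3,
    c * ‖ξ‖ ^ 2 ≤ inner ℝ ξ (Matrix.toEuclideanLin (A x) ξ)

/-- The bilinear form `a(v, w) = ∫_Ω ν curl v · curl w + ∫_Ω ε v · w`. -/
def curlForm {Ω : Set E3} (ν ε : E3 → Matrix (Fin 3) (Fin 3) ℝ) (v w : HCurl Ω) : ℝ :=
  (∫ x in Ω, inner ℝ (Matrix.toEuclideanLin (ν x) (curlField v x)) (curlField w x)) +
    ∫ x in Ω, inner ℝ (Matrix.toEuclideanLin (ε x) (vecField v x)) (vecField w x)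

/-- The non-smooth functional `φ_s(v) = j_c ∫_s |v|`. -/
def nonsmooth (jc : ℝ) (s : Set E3) (v : E3 → E3) : ℝ := jc * ∫ x in s, ‖v x‖

/-- `e` is a solution in `H₀(curl)` of the variational inequality associated with the shape `s`. -/
def IsVISolution {Ω : Set E3} (ν ε : E3 → Matrix (Fin 3) (Fin 3) ℝ) (jc : ℝ) (f : E3 → E3)
    (s : Set E3) (e : HCurl Ω) : Prop :=
  e ∈ H0Curl Ω ∧ ∀ v ∈ H0Curl Ω,
    (∫ x in Ω, inner ℝ (f x) (vecField (v - e) x)) ≤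
      curlForm ν ε e (v - e) + nonsmooth jc s (vecField v) - nonsmooth jc s (vecField e)

/-- The electric field `E(s)`: the solution of the variational inequality associated with `s`. -/
def electricField (Ω : Set E3) (ν ε : E3 → Matrix (Fin 3) (Fin 3) ℝ) (jc : ℝ) (f : E3 → E3)
    (s : Set E3) : HCurl Ω :=
  Classical.epsilon (IsVISolution ν ε jc f s)

/-- The cost functional `J(s) = 1/2 ∫_B κ |E(s) - E_d|² + ∫_s 1`. -/
def cost (Ω B : Set E3) (ν ε : E3 → Matrix (Fin 3) (Fin 3) ℝ) (jc : ℝ) (f : E3 → E3)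
    (κ : E3 → ℝ) (Ed : E3 → E3) (s : Set E3) : ℝ :=
  1 / 2 * (∫ x in B, κ x * ‖vecField (electricField Ω ν ε jc f s) x - Ed x‖ ^ 2) +
    ∫ _x in s, (1 : ℝ)

end

end ShapeOpt

open ShapeOpt

namespace ShapeOpt

open Filter Topology Metric Set

/-! ### Limits of isometries and Lipschitz functions along an ultrafilter -/

/-! This is the direct method: the shapes are compact in measure, and the cost is continuous for
that convergence.

Compactness. An ultrafilter `U` replaces subsequences. The limit shape is `interiorLimit U s`, and
the corresponding limit of the complements is a disjoint open set. A point in neither is a limit of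
boundary points of the `s i`. The frames and graph functions there are bounded pointwise, so they
converge pointwise along `U`, with the same `L` and `δ`; strictly above the limit graph lies the
limit shape, strictly below it the limit of the complements (`exists_graph_of_mem_limitBoundary`).
Hence the limit shape is admissible, and the leftover set is null, being locally part of a Lipschitz
graph. Away from a small open neighbourhood of the leftover set, compactness of `closure B` makes
the agreement of `s i` with the limit uniform (`tendsto_volume_symmDiff_interiorLimit`).

Continuity. The state minimises a strongly convex energy. Testing the inequalities for two shapes
with each other's solution bounds the `H(curl)` distance of the states by a constant times the
square root of the volume of the symmetric difference (`exists_isVISolution_norm_sub_le`). The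
states therefore converge strongly, and no compact embedding is needed. -/

theorem exists_tendsto_of_norm_le {ι F : Type*} [NormedAddCommGroup F] [ProperSpace F]
    (U : Ultrafilter ι) {f : ι → F} {C : ℝ} (h : ∀ i, ‖f i‖ ≤ C) :
    ∃ y, Tendsto f U (𝓝 y) := by
  obtain ⟨y, -, hy⟩ := (isCompact_closedBall (0 : F) C).ultrafilter_le_nhds (U.map f)
    (by
      rw [le_principal_iff, Ultrafilter.mem_coe, Ultrafilter.mem_map]
      exact univ_mem' fun i => by simpa using h i)
  exact ⟨y, hy⟩

/-- Linearity and preservation of norms survive pointwise limits, and a linear isometry of a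
finite-dimensional space into itself is onto. -/
theorem exists_tendsto_linearIsometryEquiv {ι E : Type*} [NormedAddCommGroup E]
    [InnerProductSpace ℝ E] [FiniteDimensional ℝ E] (U : Ultrafilter ι) (R : ι → E ≃ₗᵢ[ℝ] E) :
    ∃ R₀ : E ≃ₗᵢ[ℝ] E, ∀ y, Tendsto (fun i => R i y) U (𝓝 (R₀ y)) := by
  have := FiniteDimensional.proper_real E
  have h : ∀ y : E, ∃ z, Tendsto (fun i => R i y) U (𝓝 z) := fun y =>
    exists_tendsto_of_norm_le U (C := ‖y‖) fun i => by simp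
  choose S hS using h
  let T : E →ₗᵢ[ℝ] E :=
    { toFun := S
      map_add' := fun x y => tendsto_nhds_unique (hS (x + y)) (by simpa using (hS x).add (hS y))
      map_smul' := fun c x => tendsto_nhds_unique (hS (c • x)) (by simpa using (hS x).const_smul c)
      norm_map' := fun x => tendsto_nhds_unique (hS x).norm (by simp) }
  exact ⟨T.toLinearIsometryEquiv rfl, fun y => hS y⟩

/-- The normalisation at `0` bounds the values at `y` by `L * ‖y‖`, which is what makes pointwise
limits exist. -/
theorem exists_tendsto_lipschitzWith {ι E : Type*} [NormedAddCommGroup E] (U : Ultrafilter ι)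
    {L : ℝ≥0} {g : ι → E → ℝ} (hg : ∀ i, LipschitzWith L (g i)) (h0 : ∀ i, g i 0 = 0) :
    ∃ g₀ : E → ℝ, LipschitzWith L g₀ ∧ ∀ y, Tendsto (fun i => g i y) U (𝓝 (g₀ y)) := by
  have h : ∀ y : E, ∃ z, Tendsto (fun i => g i y) U (𝓝 z) := fun y =>
    exists_tendsto_of_norm_le U (C := L * ‖y‖) fun i => by
      simpa [h0 i] using (hg i).dist_le_mul y 0
  choose g₀ hg₀ using h
  refine ⟨g₀, LipschitzWith.of_dist_le_mul fun x y => ?_, hg₀⟩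
  exact le_of_tendsto ((hg₀ x).dist (hg₀ y)) (Eventually.of_forall fun i => (hg i).dist_le_mul x y)

/-! ### The projection to the first two coordinates and Lipschitz graphs -/

theorem norm_horizontal_sub_le (y z : E3) :
    dist (!₂[z 0, z 1] : EuclideanSpace ℝ (Fin 2)) !₂[y 0, y 1] ≤ ‖z - y‖ := by
  rw [EuclideanSpace.dist_eq, EuclideanSpace.norm_eq]
  refine Real.sqrt_le_sqrt ?_
  simp [Fin.sum_univ_succ, Real.dist_eq]
  positivity

theorem continuous_horizontal :
    Continuous fun y : E3 => (!₂[y 0, y 1] : EuclideanSpace ℝ (Fin 2)) :=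
  (LipschitzWith.of_dist_le_mul (K := 1) fun y z => by
    simpa [dist_eq_norm] using norm_horizontal_sub_le z y).continuous

/-- Vertical translates of a graph by the distinct bounded heights `1 / (n + 1)` are pairwise
disjoint, which forces measure zero. -/
theorem volume_graph_eq_zero {g : EuclideanSpace ℝ (Fin 2) → ℝ} (hg : Continuous g) :
    volume {y : E3 | g !₂[y 0, y 1] = y 2} = 0 := by
  have hc : IsClosed {y : E3 | g !₂[y 0, y 1] = y 2} :=
    isClosed_eq (hg.comp continuous_horizontal) (by fun_prop)
  refine Measure.addHaar_eq_zero_of_disjoint_translates volume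
    (fun n : ℕ => EuclideanSpace.single (2 : Fin 3) ((n : ℝ) + 1)⁻¹) ?_ ?_ hc.measurableSet
  · refine isBounded_iff_forall_norm_le.2 ⟨1, ?_⟩
    rintro _ ⟨n, rfl⟩
    simp only [PiLp.norm_single, norm_inv, Real.norm_eq_abs]
    rw [abs_of_pos (by positivity)]
    exact inv_le_one_of_one_le₀ (by linarith [n.cast_nonneg (α := ℝ)])
  · intro m n hmn
    refine Set.disjoint_left.2 fun y hm hn => hmn ?_
    simp only [singleton_add, image_add_left, mem_preimage, mem_ofPred_eq] at hm hn
    simp at hm hn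
    have := hm.symm.trans hn
    simpa using this

/-! ### Interior limits of sets -/

/-- The points with a neighbourhood that is eventually contained in `s i`. -/
def interiorLimit {ι : Type*} (l : Filter ι) (s : ι → Set E3) : Set E3 :=
  {x | ∃ r > 0, ∀ᶠ i in l, ball x r ⊆ s i}

theorem ball_subset_interiorLimit {ι : Type*} {l : Filter ι} {s : ι → Set E3} {x : E3} {r : ℝ}
    (h : ∀ᶠ i in l, ball x r ⊆ s i) : ball x r ⊆ interiorLimit l s := fun y hy =>
  ⟨r - dist y x, sub_pos.2 hy, h.mono fun _ hi => (ball_subset_ball' (by linarith)).trans hi⟩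

theorem isOpen_interiorLimit {ι : Type*} (l : Filter ι) (s : ι → Set E3) :
    IsOpen (interiorLimit l s) :=
  isOpen_iff.2 fun _ ⟨r, hr, h⟩ => ⟨r, hr, ball_subset_interiorLimit h⟩

theorem disjoint_interiorLimit_compl {ι : Type*} (l : Filter ι) [l.NeBot] (s : ι → Set E3) :
    Disjoint (interiorLimit l s) (interiorLimit l fun i => (s i)ᶜ) := by
  refine Set.disjoint_left.2 ?_
  rintro x ⟨r, hr, h⟩ ⟨r', hr', h'⟩
  obtain ⟨i, hi, hi'⟩ := (h.and h').exists
  exact hi' (mem_ball_self hr') (hi (mem_ball_self hr))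

theorem interiorLimit_subset {ι : Type*} {l : Filter ι} [l.NeBot] {s : ι → Set E3} {B : Set E3}
    (h : ∀ i, s i ⊆ B) : interiorLimit l s ⊆ B := by
  rintro x ⟨r, hr, hx⟩
  obtain ⟨i, hi⟩ := hx.exists
  exact h i (hi (mem_ball_self hr))

/-- The points that are eventually approached by the boundaries. -/
def limitBoundary {ι : Type*} (l : Filter ι) (s : ι → Set E3) : Set E3 :=
  (interiorLimit l s ∪ interiorLimit l fun i => (s i)ᶜ)ᶜ

theorem frontier_interiorLimit_subset {ι : Type*} (l : Filter ι) [l.NeBot] (s : ι → Set E3) :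
    frontier (interiorLimit l s) ⊆ limitBoundary l s := by
  intro x hx
  rw [(isOpen_interiorLimit l s).frontier_eq] at hx
  rintro (h | h)
  · exact hx.2 h
  · exact ((disjoint_interiorLimit_compl l s).closure_left
      (isOpen_interiorLimit _ _)).le_bot ⟨hx.1, h⟩

/-- Along an ultrafilter, "not eventually" means "eventually not", so almost every `s i` and its
complement both meet the ball. A ball is connected, so it cannot be covered by the interior and the
exterior of `s i` alone. -/
theorem eventually_frontier_inter_ball {ι : Type*} (U : Ultrafilter ι) {s : ι → Set E3} {x : E3}
    (hx : x ∈ limitBoundary U s) {r : ℝ} (hr : 0 < r) :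
    ∀ᶠ i in U, (frontier (s i) ∩ ball x r).Nonempty := by
  simp only [limitBoundary, mem_compl_iff, mem_union, not_or, interiorLimit, mem_ofPred_eq,
    not_exists, not_and, ← Ultrafilter.eventually_not] at hx
  have h1 := hx.1 r hr
  have h2 := hx.2 r hr
  filter_upwards [h1, h2] with i h1 h2
  obtain ⟨a, ha, ha'⟩ := not_subset.1 h1
  obtain ⟨b, hb, hb'⟩ := not_subset.1 h2
  rw [notMem_compl_iff] at hb'
  by_contra hne
  have hcover : ball x r ⊆ interior (s i) ∪ (closure (s i))ᶜ := fun w hw => by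
    by_contra hc
    simp only [mem_union, mem_compl_iff, not_or, not_not] at hc
    exact hne ⟨w, ⟨hc.2, hc.1⟩, hw⟩
  have hb_int : b ∈ interior (s i) := (hcover hb).resolve_right fun h => h (subset_closure hb')
  exact ha' (interior_subset ((convex_ball x r).isPreconnected.subset_left_of_subset_union
    isOpen_interior isClosed_closure.isOpen_compl
    (disjoint_compl_right.mono_left (interior_subset.trans subset_closure)) hcover
    ⟨b, hb, hb_int⟩ ha))

theorem exists_tendsto_mem_frontier {ι : Type*} (U : Ultrafilter ι) {s : ι → Set E3} {x : E3}
    (hx : x ∈ limitBoundary U s) :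
    ∃ z : ι → E3, Tendsto z U (𝓝 x) ∧ ∀ᶠ i in U, z i ∈ frontier (s i) := by
  have h : ∀ i, ∃ z, (frontier (s i)).Nonempty → z ∈ frontier (s i) ∧
      infDist x (frontier (s i)) = dist x z := fun i => by
    by_cases hne : (frontier (s i)).Nonempty
    · obtain ⟨z, hz, hz'⟩ := isClosed_frontier.exists_infDist_eq_dist hne x
      exact ⟨z, fun _ => ⟨hz, hz'⟩⟩
    · exact ⟨x, fun h => absurd h hne⟩
  choose z hz using h
  refine ⟨z, Metric.tendsto_nhds.2 fun r hr => ?_, ?_⟩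
  · filter_upwards [eventually_frontier_inter_ball U hx hr] with i ⟨y, hy, hyr⟩
    rw [dist_comm, ← (hz i ⟨y, hy⟩).2]
    exact (infDist_le_dist_of_mem hy).trans_lt (by rwa [dist_comm])
  · filter_upwards [eventually_frontier_inter_ball U hx one_pos] with i ⟨y, hy, _⟩
    exact (hz i ⟨y, hy⟩).1

/-! ### Passing to the limit in the graph condition -/

/-- A positive value would keep a neighbourhood of `z` out of `s`; a negative one would put `z` into
the open set `s`. -/
theorem graph_zero_of_mem_frontier {s : Set E3} (hs : IsOpen s) {L : ℝ≥0} {δ : ℝ} (hδ : 0 < δ)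
    {z : E3} (hz : z ∈ frontier s) {R : E3 ≃ₗᵢ[ℝ] E3} {g : EuclideanSpace ℝ (Fin 2) → ℝ}
    (hg : LipschitzWith L g)
    (h : ∀ y : E3, ‖y‖ < δ → (z + R y ∈ s ↔ g !₂[y 0, y 1] < y 2)) : g 0 = 0 := by
  rw [hs.frontier_eq] at hz
  have e0 : (!₂[(0 : E3) 0, (0 : E3) 1] : EuclideanSpace ℝ (Fin 2)) = 0 := by
    ext i; fin_cases i <;> rfl
  refine le_antisymm ?_ ?_
  · by_contra! hpos
    have hc : Continuous fun w : E3 => g !₂[(R.symm (w - z)) 0, (R.symm (w - z)) 1] -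
        (R.symm (w - z)) 2 := by
      have h1 : Continuous fun w : E3 => R.symm (w - z) :=
        R.symm.continuous.comp (continuous_id.sub continuous_const)
      exact (hg.continuous.comp (continuous_horizontal.comp h1)).sub
        ((by fun_prop : Continuous fun y : E3 => y 2).comp h1)
    have hz0 : 0 < g !₂[(R.symm (z - z)) 0, (R.symm (z - z)) 1] - (R.symm (z - z)) 2 := by
      simp only [sub_self, map_zero, e0]
      simpa using hpos
    have hev := (hc.continuousAt.eventually (lt_mem_nhds hz0)).and (ball_mem_nhds z hδ)
    obtain ⟨w, ⟨hw, hwδ⟩, hws⟩ := mem_closure_iff_nhds.1 hz.1 _ hev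
    have := (h (R.symm (w - z)) (by
    rwa [LinearIsometryEquiv.norm_map, ← dist_eq_norm])).1 (by simpa using hws)
    linarith
  · by_contra! hneg
    refine hz.2 ?_
    simpa using (h 0 (by simpa using hδ)).2 (by rw [e0]; simpa using hneg)

/-- Equi-Lipschitz `F i` with a positive limit at `y` are eventually positive on one fixed ball
around `y`. Stating this for a general `F` covers both sides of the graph. -/
theorem add_mem_interiorLimit {ι : Type*} {l : Filter ι} {s : ι → Set E3} {δ : ℝ}
    {z : ι → E3} {x : E3} (hz : Tendsto z l (𝓝 x)) {R : ι → E3 ≃ₗᵢ[ℝ] E3} {R₀ : E3 ≃ₗᵢ[ℝ] E3}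
    (hR : ∀ y, Tendsto (fun i => R i y) l (𝓝 (R₀ y))) {K : ℝ≥0} {F : ι → E3 → ℝ} {F₀ : E3 → ℝ}
    (hF : ∀ i, LipschitzWith K (F i)) (hF₀ : ∀ y, Tendsto (fun i => F i y) l (𝓝 (F₀ y)))
    (h : ∀ᶠ i in l, ∀ y : E3, ‖y‖ < δ → 0 < F i y → z i + R i y ∈ s i)
    {y : E3} (hy : ‖y‖ < δ) (hpos : 0 < F₀ y) : x + R₀ y ∈ interiorLimit l s := by
  -- The ball of radius `η` around `y` stays within norm `δ`, and on it `F i` drops by less than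
  -- half of `F₀ y`.
  obtain ⟨η, hη, hηδ, hηK⟩ : ∃ η > 0, η < δ - ‖y‖ ∧ K * η < F₀ y / 2 := by
    have h1 : ∀ᶠ η in 𝓝[>] (0 : ℝ), η < δ - ‖y‖ :=
      (eventually_lt_nhds (sub_pos.2 hy)).filter_mono nhdsWithin_le_nhds
    have h2 : ∀ᶠ η in 𝓝[>] (0 : ℝ), K * η < F₀ y / 2 := by
      have : Tendsto (fun η : ℝ => K * η) (𝓝 0) (𝓝 0) := by
        simpa using (continuous_const_mul (K : ℝ)).tendsto 0
      exact (this.eventually (eventually_lt_nhds (half_pos hpos))).filter_mono nhdsWithin_le_nhds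
    obtain ⟨η, ⟨h1, h2⟩, h3⟩ := ((h1.and h2).and self_mem_nhdsWithin).exists
    exact ⟨η, h3, h1, h2⟩
  -- Three errors share `η`: the position in the ball, the shift from `z i` to `x`, and the rotation
  -- error at `y`.
  refine ⟨η / 3, by positivity, ?_⟩
  filter_upwards [h, Metric.tendsto_nhds.1 hz (η / 3) (by positivity),
    Metric.tendsto_nhds.1 (hR y) (η / 3) (by positivity),
    (hF₀ y).eventually (lt_mem_nhds (half_lt_self hpos))] with i hi hzi hRi hFi w hw
  set v := (R i).symm (w - z i) with hv
  have hvy : ‖v - y‖ < η := by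
    have h1 : ‖v - y‖ = ‖w - z i - R i y‖ := by
      rw [← (R i).norm_map (v - y), map_sub, hv, LinearIsometryEquiv.apply_symm_apply]
    have h2 : w - z i - R i y = (w - (x + R₀ y)) + (x - z i) + (R₀ y - R i y) := by abel
    rw [h1, h2]
    have h3 := norm_add₃_le (a := w - (x + R₀ y)) (b := x - z i) (c := R₀ y - R i y)
    rw [mem_ball, dist_eq_norm] at hw
    rw [dist_comm, dist_eq_norm] at hzi hRi
    linarith
  have h4 := hi v (by linarith [norm_sub_norm_le v y]) (by
    have h5 := (hF i).dist_le_mul v y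
    rw [dist_eq_norm v y, Real.dist_eq] at h5
    have h6 : K * ‖v - y‖ ≤ K * η := mul_le_mul_of_nonneg_left hvy.le K.2
    linarith [(abs_le.1 h5).1])
  simpa [hv] using h4

theorem exists_graph_of_mem_limitBoundary {ι : Type*} (U : Ultrafilter ι) {s : ι → Set E3}
    {L : ℝ≥0} {δ : ℝ} (hδ : 0 < δ) (hs : ∀ i, IsOpen (s i))
    (hg : ∀ i, ∀ x ∈ frontier (s i), IsLipschitzGraphNear (s i) L δ x) {x : E3}
    (hx : x ∈ limitBoundary U s) :
    ∃ (R : E3 ≃ₗᵢ[ℝ] E3) (g : EuclideanSpace ℝ (Fin 2) → ℝ), LipschitzWith L g ∧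
      ∀ y : E3, ‖y‖ < δ → (g !₂[y 0, y 1] < y 2 → x + R y ∈ interiorLimit U s) ∧
        (y 2 < g !₂[y 0, y 1] → x + R y ∈ interiorLimit U fun i => (s i)ᶜ) := by
  obtain ⟨z, hzx, hz⟩ := exists_tendsto_mem_frontier U hx
  have h : ∀ i, ∃ (R : E3 ≃ₗᵢ[ℝ] E3) (g : EuclideanSpace ℝ (Fin 2) → ℝ), LipschitzWith L g ∧
      g 0 = 0 ∧ (z i ∈ frontier (s i) →
        ∀ y : E3, ‖y‖ < δ → (z i + R y ∈ s i ↔ g !₂[y 0, y 1] < y 2)) := fun i => by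
    by_cases hi : z i ∈ frontier (s i)
    · obtain ⟨R, g, hL, h⟩ := hg i _ hi
      exact ⟨R, g, hL, graph_zero_of_mem_frontier (hs i) hδ hi hL h, fun _ => h⟩
    -- Dummy data off the boundary, so that the Lipschitz bound and the normalisation hold for every
    -- `i`.
    · exact ⟨.refl ℝ E3, 0, LipschitzWith.const' 0, rfl, fun h => absurd h hi⟩
  choose R g hL hg0 hgraph using h
  obtain ⟨R₀, hR₀⟩ := exists_tendsto_linearIsometryEquiv U R
  obtain ⟨g₀, hL₀, hg₀⟩ := exists_tendsto_lipschitzWith U hL hg0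
  have hlip : ∀ i, LipschitzWith (1 + L) fun y : E3 => y 2 - g i !₂[y 0, y 1] := fun i => by
    refine LipschitzWith.sub ?_ ?_
    · exact LipschitzWith.of_dist_le_mul fun y w => by
        simpa [dist_eq_norm] using PiLp.norm_apply_le (y - w) (2 : Fin 3)
    · refine LipschitzWith.of_dist_le_mul fun y w => ((hL i).dist_le_mul _ _).trans ?_
      exact mul_le_mul_of_nonneg_left ((norm_horizontal_sub_le w y).trans_eq
        (dist_eq_norm _ _).symm) L.2
  refine ⟨R₀, g₀, hL₀, fun y hy => ⟨fun hlt => ?_, fun hlt => ?_⟩⟩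
  · refine add_mem_interiorLimit hzx hR₀ hlip (fun y => tendsto_const_nhds.sub (hg₀ _)) ?_ hy
      (sub_pos.2 hlt)
    filter_upwards [hz] with i hi y hy hpos using (hgraph i hi y hy).2 (sub_pos.1 hpos)
  -- The complements are handled by reversing the sign of the height above the graph.
  · refine add_mem_interiorLimit (F := fun i (y : E3) => -(y 2 - g i !₂[y 0, y 1]))
      (F₀ := fun y : E3 => -(y 2 - g₀ !₂[y 0, y 1])) hzx hR₀ (fun i => (hlip i).neg)
      (fun y => (tendsto_const_nhds.sub (hg₀ _)).neg) ?_ hy (by simpa using hlt)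
    filter_upwards [hz] with i hi y hy hpos hmem
    have := (hgraph i hi y hy).1 hmem
    linarith

/-- Points on the graph itself are excluded by openness: a slight push downwards would stay in the
limit set and also land in the limit of the complements. -/
theorem isLipschitzGraphNear_interiorLimit {ι : Type*} (U : Ultrafilter ι) {s : ι → Set E3}
    {δ : ℝ} {x : E3} {R : E3 ≃ₗᵢ[ℝ] E3} {g : EuclideanSpace ℝ (Fin 2) → ℝ}
    (h : ∀ y : E3, ‖y‖ < δ → (g !₂[y 0, y 1] < y 2 → x + R y ∈ interiorLimit U s) ∧
        (y 2 < g !₂[y 0, y 1] → x + R y ∈ interiorLimit U fun i => (s i)ᶜ))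
    {y : E3} (hy : ‖y‖ < δ) : x + R y ∈ interiorLimit U s ↔ g !₂[y 0, y 1] < y 2 := by
  refine ⟨fun hmem => ?_, (h y hy).1⟩
  by_contra! hle
  let w : ℝ → E3 := fun t => y - t • EuclideanSpace.single (2 : Fin 3) (1 : ℝ)
  have hw : Continuous w := by fun_prop
  have hw0 : w 0 = y := by simp [w]
  have h1 : ∀ᶠ t in 𝓝[>] (0 : ℝ), x + R (w t) ∈ interiorLimit U s := by
    have hc : Continuous fun t => x + R (w t) := continuous_const.add (R.continuous.comp hw)
    refine (hc.continuousAt.eventually ((isOpen_interiorLimit U s).mem_nhds ?_)).filter_mono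
      nhdsWithin_le_nhds
    simpa only [hw0]
  have h2 : ∀ᶠ t in 𝓝[>] (0 : ℝ), ‖w t‖ < δ := by
    refine (hw.norm.continuousAt.eventually (gt_mem_nhds ?_)).filter_mono nhdsWithin_le_nhds
    simpa only [hw0]
  obtain ⟨t, ⟨h1, h2⟩, h3 : 0 < t⟩ := ((h1.and h2).and self_mem_nhdsWithin).exists
  refine (disjoint_interiorLimit_compl (U : Filter ι) s).le_bot ⟨h1, (h _ h2).2 ?_⟩
  simp [w]
  linarith

theorem interiorLimit_mem_admissibleShapes {ι : Type*} (U : Ultrafilter ι) {s : ι → Set E3}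
    {B : Set E3} {L : ℝ≥0} {δ : ℝ} (hδ : 0 < δ) (hs : ∀ i, s i ∈ admissibleShapes B L δ) :
    interiorLimit U s ∈ admissibleShapes B L δ := by
  refine ⟨interiorLimit_subset fun i => (hs i).1, isOpen_interiorLimit _ _, fun x hx => ?_⟩
  obtain ⟨R, g, hL, h⟩ := exists_graph_of_mem_limitBoundary U hδ (fun i => (hs i).2.1)
    (fun i => (hs i).2.2) (frontier_interiorLimit_subset _ _ hx)
  exact ⟨R, g, hL, fun y hy => isLipschitzGraphNear_interiorLimit U h hy⟩

theorem volume_limitBoundary {ι : Type*} (U : Ultrafilter ι) {s : ι → Set E3}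
    {B : Set E3} {L : ℝ≥0} {δ : ℝ} (hδ : 0 < δ) (hs : ∀ i, s i ∈ admissibleShapes B L δ) :
    volume (limitBoundary U s) = 0 := by
  refine measure_null_of_locally_null _ fun x hx => ?_
  obtain ⟨R, g, hL, h⟩ := exists_graph_of_mem_limitBoundary U hδ (fun i => (hs i).2.1)
    (fun i => (hs i).2.2) hx
  refine ⟨limitBoundary U s ∩ ball x δ,
    inter_mem self_mem_nhdsWithin (mem_nhdsWithin_of_mem_nhds (ball_mem_nhds x hδ)), ?_⟩
  have hmp : MeasurePreserving (fun w : E3 => R.symm (w - x)) volume volume :=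
    R.symm.measurePreserving.comp (measurePreserving_sub_right volume x)
  have hnull := hmp.quasiMeasurePreserving.preimage_null (volume_graph_eq_zero hL.continuous)
  refine measure_mono_null ?_ hnull
  rintro w ⟨hw, hwδ⟩
  simp only [limitBoundary, mem_compl_iff, mem_union, not_or] at hw
  obtain ⟨h1, h2⟩ := h (R.symm (w - x)) (by
    rwa [LinearIsometryEquiv.norm_map, ← dist_eq_norm])
  simp only [LinearIsometryEquiv.apply_symm_apply, add_sub_cancel] at h1 h2
  exact le_antisymm (not_lt.1 fun hlt => hw.2 (h2 hlt)) (not_lt.1 fun hlt => hw.1 (h1 hlt))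

/-- Compactness of the admissible shapes: along an ultrafilter they converge in measure. -/
theorem tendsto_volume_symmDiff_interiorLimit {ι : Type*} (U : Ultrafilter ι) {s : ι → Set E3}
    {B : Set E3} (hB : Bornology.IsBounded B) {L : ℝ≥0} {δ : ℝ} (hδ : 0 < δ)
    (hs : ∀ i, s i ∈ admissibleShapes B L δ) :
    Tendsto (fun i => volume (symmDiff (s i) (interiorLimit U s))) U (𝓝 0) := by
  refine ENNReal.tendsto_nhds_zero.2 fun η hη => ?_
  obtain ⟨V, hNV, hV, hVη⟩ := (limitBoundary U s).exists_isOpen_lt_of_lt η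
    (by rwa [volume_limitBoundary U hδ hs])
  have hK : IsCompact (closure B \ V) := hB.isCompact_closure.diff hV
  have hsub : interiorLimit U s ⊆ B := interiorLimit_subset fun i => (hs i).1
  -- Each point of this compact set has a ball on which `s i` eventually agrees with the limit, and
  -- finitely many such balls suffice.
  have hev : ∀ᶠ i in U, Disjoint (symmDiff (s i) (interiorLimit U s)) (closure B \ V) := by
    refine hK.induction_on (p := fun t => ∀ᶠ i in U,
      Disjoint (symmDiff (s i) (interiorLimit U s)) t) (by simp) ?_ ?_ ?_
    · exact fun t t' htt' h => h.mono fun i hi => hi.mono_right htt'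
    · exact fun t t' h h' => (h.and h').mono fun i hi => hi.1.union_right hi.2
    · intro x hx
      have hx' : x ∈ interiorLimit U s ∪ interiorLimit U fun i => (s i)ᶜ := by
        by_contra hc
        exact hx.2 (hNV hc)
      rcases hx' with ⟨r, hr, h⟩ | ⟨r, hr, h⟩
      · refine ⟨ball x r, mem_nhdsWithin_of_mem_nhds (ball_mem_nhds x hr), ?_⟩
        filter_upwards [h] with i hi
        refine Set.disjoint_left.2 ?_
        rintro w (⟨-, hw⟩ | ⟨-, hw⟩) hwr
        · exact hw (ball_subset_interiorLimit h hwr)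
        · exact hw (hi hwr)
      · refine ⟨ball x r, mem_nhdsWithin_of_mem_nhds (ball_mem_nhds x hr), ?_⟩
        filter_upwards [h] with i hi
        refine Set.disjoint_left.2 ?_
        rintro w (⟨hw, -⟩ | ⟨hw, -⟩) hwr
        · exact hi hwr hw
        · exact (disjoint_interiorLimit_compl (U : Filter ι) s).le_bot
            ⟨hw, ball_subset_interiorLimit h hwr⟩
  filter_upwards [hev] with i hi
  refine (measure_mono fun w hw => ?_).trans hVη.le
  by_contra hwV
  refine Set.disjoint_left.1 hi hw ⟨subset_closure ?_, hwV⟩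
  rcases hw with ⟨hw, -⟩ | ⟨hw, -⟩
  · exact (hs i).1 hw
  · exact hsub hw

/-! ### Elliptic variational inequalities of the second kind -/

section VariationalInequality

variable {X : Type*} [NormedAddCommGroup X] [NormedSpace ℝ X]

/-- Bounded symmetric coercive bilinear forms. -/
def IsCoerciveSymmForm (a : X → X → ℝ) : Prop :=
  ∃ b : X →L[ℝ] X →L[ℝ] ℝ, (∀ v w, b v w = a v w) ∧ (∀ v w, b v w = b w v) ∧
    ∃ c > 0, ∀ v, c * ‖v‖ ^ 2 ≤ b v v

theorem quadratic_lineMap (a : X →L[ℝ] X →L[ℝ] ℝ) (hsymm : ∀ v w, a v w = a w v) (u v : X)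
    (t : ℝ) : a (u + t • (v - u)) (u + t • (v - u)) =
      a u u + 2 * t * a u (v - u) + t ^ 2 * a (v - u) (v - u) := by
  simp only [map_add, map_smul, add_apply,
    smul_apply, smul_eq_mul]
  rw [hsymm (v - u) u]
  ring

theorem convex_lineMap_le {F : X → ℝ} (hF : ConvexOn ℝ univ F) (u v : X) {t : ℝ} (ht0 : 0 ≤ t)
    (ht1 : t ≤ 1) : F (u + t • (v - u)) ≤ (1 - t) * F u + t * F v := by
  have h := hF.2 (mem_univ u) (mem_univ v) (sub_nonneg.2 ht1) ht0 (by ring)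
  have e : (1 - t) • u + t • v = u + t • (v - u) := by module
  rwa [e] at h

/-- Compare `u` with `u + t • (v - u)`, divide by `t` and let `t` decrease to `0`; convexity
replaces differentiability of `F`. -/
theorem variationalInequality_of_isMinOn {K : Submodule ℝ X} (a : X →L[ℝ] X →L[ℝ] ℝ)
    (hsymm : ∀ v w, a v w = a w v) {F : X → ℝ} (hF : ConvexOn ℝ univ F) {u : X} (hu : u ∈ K)
    (hmin : ∀ v ∈ K, 1 / 2 * a u u + F u ≤ 1 / 2 * a v v + F v) {v : X} (hv : v ∈ K) :
    0 ≤ a u (v - u) + F v - F u := by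
  have h : ∀ᶠ t in 𝓝[>] (0 : ℝ),
      0 ≤ a u (v - u) + F v - F u + t * (1 / 2 * a (v - u) (v - u)) := by
    have h1 : ∀ᶠ t in 𝓝[>] (0 : ℝ), t ≤ 1 :=
      (eventually_le_nhds one_pos).filter_mono nhdsWithin_le_nhds
    filter_upwards [h1, self_mem_nhdsWithin] with t ht1 (ht0 : 0 < t)
    have h2 := hmin _ (K.add_mem hu (K.smul_mem t (K.sub_mem hv hu)))
    rw [quadratic_lineMap a hsymm] at h2
    have h3 := convex_lineMap_le hF u v ht0.le ht1
    refine nonneg_of_mul_nonneg_right (a := t) ?_ ht0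
    linarith
  refine ge_of_tendsto (f := fun t : ℝ =>
    a u (v - u) + F v - F u + t * (1 / 2 * a (v - u) (v - u))) ?_ h
  have hc : Continuous fun t : ℝ =>
    a u (v - u) + F v - F u + t * (1 / 2 * a (v - u) (v - u)) := by fun_prop
  simpa using (hc.tendsto 0).mono_left nhdsWithin_le_nhds

/-- Strong convexity makes a minimising sequence of `1 / 2 * a v v + F v` Cauchy, so weak
compactness is not needed. -/
theorem exists_variationalInequality [CompleteSpace X] {K : Submodule ℝ X}
    (hK : IsClosed (K : Set X)) {a₀ : X → X → ℝ} (ha : IsCoerciveSymmForm a₀) {F : X → ℝ}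
    (hF : ConvexOn ℝ univ F) (hFc : Continuous F) {C : ℝ} (hFb : ∀ v, -(C * ‖v‖) ≤ F v) :
    ∃ u ∈ K, ∀ v ∈ K, 0 ≤ a₀ u (v - u) + F v - F u := by
  obtain ⟨a, hab, hsymm, c, hc, hcoer⟩ := ha
  simp only [← hab]
  let I : X → ℝ := fun v => 1 / 2 * a v v + F v
  have hIc : Continuous I := by
    have : Continuous fun v : X => a v v := a.continuous.clm_apply continuous_id
    exact (continuous_const.mul this).add hFc
  have hbdd : BddBelow (I '' K) := by
    -- The minimum of `c / 2 * r ^ 2 - C * r` over `r`.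
    refine ⟨-(C ^ 2 / (2 * c)), ?_⟩
    rintro _ ⟨v, -, rfl⟩
    have h1 := hcoer v
    have h2 := hFb v
    have h3 : 0 ≤ c / 2 * (‖v‖ - C / c) ^ 2 := by positivity
    have h4 : c / 2 * (‖v‖ - C / c) ^ 2 = 1 / 2 * (c * ‖v‖ ^ 2) - C * ‖v‖ + C ^ 2 / (2 * c) := by
      field_simp
      ring
    simp only [I]
    linarith
  have hne : (I '' K).Nonempty := ⟨_, 0, K.zero_mem, rfl⟩
  set m := sInf (I '' K) with hm
  have hle : ∀ v ∈ K, m ≤ I v := fun v hv => csInf_le hbdd ⟨v, hv, rfl⟩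
  have hseq : ∀ n : ℕ, ∃ u ∈ K, I u < m + 1 / ((n : ℝ) + 1) := fun n => by
    obtain ⟨_, ⟨u, hu, rfl⟩, h⟩ := exists_lt_of_csInf_lt hne
      (lt_add_of_pos_right m (Nat.one_div_pos_of_nat (n := n)))
    exact ⟨u, hu, h⟩
  choose u huK hu using hseq
  -- At the midpoint the energy is below the average by at least `a (w - v) (w - v) / 8`, yet it is
  -- still at least `m`.
  have hmid : ∀ v ∈ K, ∀ w ∈ K, c / 8 * ‖w - v‖ ^ 2 ≤ 1 / 2 * I v + 1 / 2 * I w - m := by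
    intro v hv w hw
    have h1 := hle _ (K.add_mem hv (K.smul_mem (1 / 2 : ℝ) (K.sub_mem hw hv)))
    have h2 := convex_lineMap_le hF v w (t := 1 / 2) (by norm_num) (by norm_num)
    have h3 := quadratic_lineMap a hsymm v w (1 / 2)
    have h4 := quadratic_lineMap a hsymm v w 1
    have h5 := hcoer (w - v)
    rw [one_smul, add_sub_cancel] at h4
    simp only [I] at h1 ⊢
    rw [h3] at h1
    linarith
  have hdist : ∀ n k N : ℕ, N ≤ n → N ≤ k →
      dist (u n) (u k) ≤ Real.sqrt (8 / c * (1 / ((N : ℝ) + 1))) := by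
    intro n k N hn hk
    refine Real.le_sqrt_of_sq_le ?_
    have h1 := hmid _ (huK k) _ (huK n)
    have h2 := (hu n).le.trans (add_le_add_right (Nat.one_div_le_one_div hn) m)
    have h3 := (hu k).le.trans (add_le_add_right (Nat.one_div_le_one_div hk) m)
    rw [dist_eq_norm]
    have h4 : c / 8 * ‖u n - u k‖ ^ 2 ≤ 1 / ((N : ℝ) + 1) := by linarith
    calc ‖u n - u k‖ ^ 2 = 8 / c * (c / 8 * ‖u n - u k‖ ^ 2) := by field_simp
      _ ≤ _ := mul_le_mul_of_nonneg_left h4 (by positivity)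
  have hcauchy : CauchySeq u := by
    refine cauchySeq_of_le_tendsto_0 _ hdist ?_
    simpa using ((tendsto_one_div_add_atTop_nhds_zero_nat (𝕜 := ℝ)).const_mul (8 / c)).sqrt
  obtain ⟨u₀, hu₀⟩ := cauchySeq_tendsto_of_complete hcauchy
  have hu₀K : u₀ ∈ K := hK.mem_of_tendsto hu₀ (Eventually.of_forall huK)
  have hIu₀ : I u₀ ≤ m := by
    refine le_of_tendsto_of_tendsto ((hIc.tendsto u₀).comp hu₀)
      (by simpa using (tendsto_one_div_add_atTop_nhds_zero_nat (𝕜 := ℝ)).const_add m)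
      (Eventually.of_forall fun n => (hu n).le)
  exact ⟨u₀, hu₀K, fun v hv => variationalInequality_of_isMinOn a hsymm hF hu₀K
    (fun w hw => hIu₀.trans (hle w hw)) hv⟩

theorem IsCoerciveSymmForm.exists_sub_le {a : X → X → ℝ} (ha : IsCoerciveSymmForm a) :
    ∃ c > 0, ∀ u v, c * ‖u - v‖ ^ 2 ≤ -a u (v - u) - a v (u - v) := by
  obtain ⟨b, hb, -, c, hc, h⟩ := ha
  refine ⟨c, hc, fun u v => (h (u - v)).trans_eq ?_⟩
  rw [← hb, ← hb, ← neg_sub u v, map_neg, neg_neg, map_sub b u v, sub_apply]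

end VariationalInequality

/-! ### The space `H(curl)` -/

/-- Each test field imposes one equation between continuous functionals of the pair. -/
theorem isClosed_HCurl (Ω : Set E3) :
    IsClosed (HCurl Ω : Set (WithLp 2 (L2 Ω × L2 Ω))) := by
  have e : ∀ (a : L2 Ω) {ψ : E3 → E3} (hψ : MemLp ψ 2 (volume.restrict Ω)),
      ∫ x in Ω, inner ℝ (a x) (ψ x) = inner ℝ a hψ.toLp := fun a ψ hψ => by
    rw [L2.inner_def]
    refine integral_congr_ae ?_
    filter_upwards [hψ.coeFn_toLp] with x hx
    rw [hx]
  have h : (HCurl Ω : Set (WithLp 2 (L2 Ω × L2 Ω))) =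
      ⋂ (φ : E3 → E3) (hφ : IsTestField Ω φ), {u | (inner ℝ u.fst hφ.curl_memLp.toLp : ℝ) =
        inner ℝ u.snd hφ.memLp.toLp} := by
    ext u
    simp only [mem_iInter, mem_ofPred_eq, ← e]
    rfl
  rw [h]
  refine isClosed_iInter fun φ => isClosed_iInter fun hφ => isClosed_eq ?_ ?_
  · exact (WithLp.fstL 2 ℝ (L2 Ω) (L2 Ω)).continuous.inner continuous_const
  · exact (WithLp.sndL 2 ℝ (L2 Ω) (L2 Ω)).continuous.inner continuous_const

instance completeSpace_HCurl (Ω : Set E3) : CompleteSpace (HCurl Ω) :=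
  (isClosed_HCurl Ω).completeSpace_coe

/-- The field of an element of `H(curl)`, as a continuous linear map. -/
noncomputable def vecFieldCLM (Ω : Set E3) : HCurl Ω →L[ℝ] L2 Ω :=
  (WithLp.fstL 2 ℝ (L2 Ω) (L2 Ω)).comp (HCurl Ω).subtypeL

/-- The curl of an element of `H(curl)`, as a continuous linear map. -/
noncomputable def curlFieldCLM (Ω : Set E3) : HCurl Ω →L[ℝ] L2 Ω :=
  (WithLp.sndL 2 ℝ (L2 Ω) (L2 Ω)).comp (HCurl Ω).subtypeL

theorem norm_sq_HCurl {Ω : Set E3} (u : HCurl Ω) :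
    ‖u‖ ^ 2 = ‖vecField u‖ ^ 2 + ‖curlField u‖ ^ 2 :=
  WithLp.prod_norm_sq_eq_of_L2 (u : WithLp 2 (L2 Ω × L2 Ω))

theorem norm_vecField_le {Ω : Set E3} (u : HCurl Ω) : ‖vecField u‖ ≤ ‖u‖ :=
  (pow_le_pow_iff_left₀ (norm_nonneg _) (norm_nonneg _) two_ne_zero).1
    (by rw [norm_sq_HCurl u]; linarith [sq_nonneg ‖curlField u‖])

/-! ### Bilinear forms with bounded coefficients -/

/-- Hölder's inequality makes multiplication by a bounded operator field continuous on `L²`. -/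
theorem exists_coefficientForm {α : Type*} [MeasurableSpace α] {μ : Measure α}
    {T : α → E3 →L[ℝ] E3} (hT : MemLp T ∞ μ) :
    ∃ b : Lp E3 2 μ →L[ℝ] Lp E3 2 μ →L[ℝ] ℝ,
      ∀ v w, Integrable (fun x => (inner ℝ (T x (v x)) (w x) : ℝ)) μ ∧
        b v w = ∫ x, inner ℝ (T x (v x)) (w x) ∂μ := by
  let S : Lp (E3 →L[ℝ] E3) ∞ μ := hT.toLp
  let M : Lp E3 2 μ →L[ℝ] Lp E3 2 μ :=
    (ContinuousLinearMap.id ℝ (E3 →L[ℝ] E3)).holderL μ ∞ 2 2 S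
  refine ⟨(innerSL ℝ).comp M, fun v w => ?_⟩
  have h1 : M v =ᵐ[μ] fun x => S x (v x) :=
    (ContinuousLinearMap.id ℝ (E3 →L[ℝ] E3)).coeFn_holder (r := 2) S v
  have h2 : (fun x => (inner ℝ (M v x) (w x) : ℝ)) =ᵐ[μ] fun x => inner ℝ (T x (v x)) (w x) := by
    filter_upwards [h1, hT.coeFn_toLp] with x hx hx'
    rw [hx, hx']
  refine ⟨(L2.integrable_inner (𝕜 := ℝ) (M v) w).congr h2, ?_⟩
  change inner ℝ (M v) w = _
  rw [L2.inner_def]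
  exact integral_congr_ae h2

theorem memLp_sum_smul_const {α κ F : Type*} [MeasurableSpace α] {μ : Measure α} [Fintype κ]
    [NormedAddCommGroup F] [NormedSpace ℝ F] {p : ℝ≥0∞} {f : κ → α → ℝ}
    (hf : ∀ k, MemLp (f k) p μ) (c : κ → F) : MemLp (fun x => ∑ k, f k x • c k) p μ := by
  have h : ∀ k, MemLp (fun x => f k x • c k) p μ := fun k =>
    (ContinuousLinearMap.smulRight (ContinuousLinearMap.id ℝ ℝ) (c k)).comp_memLp' (hf k)
  exact memLp_finsetSum (f := fun k x => f k x • c k) Finset.univ fun k _ => h k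

theorem memLp_toEuclideanCLM {α : Type*} [MeasurableSpace α] {μ : Measure α}
    {A : α → Matrix (Fin 3) (Fin 3) ℝ} {p : ℝ≥0∞} (hA : ∀ i j, MemLp (fun x => A x i j) p μ) :
    MemLp (fun x => Matrix.toEuclideanCLM (n := Fin 3) (𝕜 := ℝ) (A x)) p μ := by
  have h : (fun x => Matrix.toEuclideanCLM (n := Fin 3) (𝕜 := ℝ) (A x)) = fun x =>
      ∑ k : Fin 3 × Fin 3, A x k.1 k.2 •
        Matrix.toEuclideanCLM (n := Fin 3) (𝕜 := ℝ) (Matrix.single k.1 k.2 1) := by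
    funext x
    conv_lhs => rw [Matrix.matrix_eq_sum_single (A x)]
    rw [← Finset.sum_product']
    simp only [map_sum]
    refine Finset.sum_congr rfl fun k _ => ?_
    rw [← map_smul, Matrix.smul_single, smul_eq_mul, mul_one]
  rw [h]
  exact memLp_sum_smul_const (f := fun (k : Fin 3 × Fin 3) x => A x k.1 k.2)
    (fun k => hA k.1 k.2)
    (fun k => Matrix.toEuclideanCLM (n := Fin 3) (𝕜 := ℝ) (Matrix.single k.1 k.2 1))

theorem isCoerciveSymmForm_material {Ω B : Set E3} {A : E3 → Matrix (Fin 3) (Fin 3) ℝ}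
    (hA : IsMaterialParameter Ω B A) : IsCoerciveSymmForm fun v w : L2 Ω =>
      ∫ x in Ω, inner ℝ (Matrix.toEuclideanLin (A x) (v x)) (w x) := by
  obtain ⟨b, hb'⟩ := exists_coefficientForm (memLp_toEuclideanCLM hA.memLp_top)
  have hb : ∀ v w, b v w = ∫ x in Ω, inner ℝ (Matrix.toEuclideanLin (A x) (v x)) (w x) :=
    fun v w => (hb' v w).2
  refine ⟨b, hb, fun v w => ?_, ?_⟩
  · rw [hb, hb]
    refine integral_congr_ae ?_
    filter_upwards [hA.symm] with x hx
    have hs : (Matrix.toEuclideanLin (A x)).IsSymmetric :=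
      Matrix.isSymmetric_toEuclideanLin_iff.2 (by
        rw [Matrix.IsHermitian, Matrix.conjTranspose_eq_transpose_of_trivial]; exact hx)
    exact (hs _ _).trans (real_inner_comm _ _)
  · obtain ⟨c, hc, h⟩ := hA.posDef
    refine ⟨c, hc, fun v => ?_⟩
    rw [hb, ← real_inner_self_eq_norm_sq, L2.inner_def, ← integral_const_mul]
    refine integral_mono_ae ((L2.integrable_inner v v).const_mul c) (hb' v v).1 ?_
    filter_upwards [h] with x hx
    have := hx (v x)
    rwa [real_inner_comm, ← real_inner_self_eq_norm_sq] at this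

theorem isCoerciveSymmForm_pullback_add {X Y : Type*} [NormedAddCommGroup X] [NormedSpace ℝ X]
    [NormedAddCommGroup Y] [NormedSpace ℝ Y] (p q : X →L[ℝ] Y)
    (hpq : ∀ u, ‖u‖ ^ 2 = ‖p u‖ ^ 2 + ‖q u‖ ^ 2) {b b' : Y → Y → ℝ}
    (hb : IsCoerciveSymmForm b) (hb' : IsCoerciveSymmForm b') :
    IsCoerciveSymmForm fun v w => b (q v) (q w) + b' (p v) (p w) := by
  obtain ⟨b, hb, hs, c, hc, h⟩ := hb
  obtain ⟨b', hb', hs', c', hc', h'⟩ := hb'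
  have key : ∀ v w, (b.bilinearComp q q + b'.bilinearComp p p) v w =
      b (q v) (q w) + b' (p v) (p w) := fun v w => rfl
  refine ⟨b.bilinearComp q q + b'.bilinearComp p p, fun v w => ?_, fun v w => ?_,
    min c c', lt_min hc hc', fun v => ?_⟩
  · rw [key, hb, hb']
  · rw [key, key, hs, hs']
  · rw [key, hpq, mul_add, add_comm]
    refine add_le_add (le_trans ?_ (h _)) (le_trans ?_ (h' _))
    · exact mul_le_mul_of_nonneg_right (min_le_left _ _) (sq_nonneg _)
    · exact mul_le_mul_of_nonneg_right (min_le_right _ _) (sq_nonneg _)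

theorem isCoerciveSymmForm_curlForm {Ω B : Set E3} {ν ε : E3 → Matrix (Fin 3) (Fin 3) ℝ}
    (hν : IsMaterialParameter Ω B ν) (hε : IsMaterialParameter Ω B ε) :
    IsCoerciveSymmForm (curlForm (Ω := Ω) ν ε) :=
  isCoerciveSymmForm_pullback_add (vecFieldCLM Ω) (curlFieldCLM Ω) norm_sq_HCurl
    (isCoerciveSymmForm_material hν) (isCoerciveSymmForm_material hε)

/-! ### Integrals of norms over subdomains -/

theorem memLp_restrict_of_subset {Ω D : Set E3} (hD : D ⊆ Ω) (v : L2 Ω) :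
    MemLp v 2 (volume.restrict D) :=
  (Lp.memLp v).mono_measure (Measure.restrict_mono hD le_rfl)

theorem integrableOn_norm {Ω D : Set E3} (hD : D ⊆ Ω) (hfin : volume D ≠ ∞) (v : L2 Ω) :
    IntegrableOn (fun x => ‖v x‖) D := by
  have : IsFiniteMeasure (volume.restrict D) := isFiniteMeasure_restrict.2 hfin
  exact ((memLp_restrict_of_subset hD v).integrable one_le_two).norm

/-- Cauchy–Schwarz against the constant `1`; this is the source of the square root of the volume in
the stability estimate. -/
theorem setIntegral_norm_le {Ω D : Set E3} (hD : D ⊆ Ω) (hfin : volume D ≠ ∞) (v : L2 Ω) :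
    ∫ x in D, ‖v x‖ ≤ ‖v‖ * Real.sqrt (volume.real D) := by
  have : IsFiniteMeasure (volume.restrict D) := isFiniteMeasure_restrict.2 hfin
  have hv := memLp_restrict_of_subset hD v
  have h1 := eLpNorm_le_eLpNorm_mul_rpow_measure_univ (one_le_two : (1 : ℝ≥0∞) ≤ 2) hv.1
  have h2 : eLpNorm v 2 (volume.restrict D) ≤ eLpNorm v 2 (volume.restrict Ω) :=
    eLpNorm_mono_measure _ (Measure.restrict_mono hD le_rfl)
  have h3 := h1.trans (mul_le_mul_left h2 _)
  rw [eLpNorm_one_eq_lintegral_enorm, Measure.restrict_apply_univ] at h3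
  rw [integral_norm_eq_lintegral_enorm hv.1, Lp.norm_def, Measure.real, Real.sqrt_eq_rpow,
    ENNReal.toReal_rpow, ← ENNReal.toReal_mul]
  have e : (1 / (1 : ℝ≥0∞).toReal - 1 / (2 : ℝ≥0∞).toReal : ℝ) = 1 / 2 := by norm_num
  rw [e] at h3
  exact ENNReal.toReal_mono (ENNReal.mul_ne_top (Lp.eLpNorm_ne_top v)
    (ENNReal.rpow_ne_top_of_nonneg (by norm_num) hfin)) h3

theorem setIntegral_sub_setIntegral_le {s t : Set E3} (hs : MeasurableSet s)
    (ht : MeasurableSet t) {h : E3 → ℝ} (hi : IntegrableOn h s) (hi' : IntegrableOn h t) :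
    (∫ x in s, h x) - ∫ x in t, h x ≤ ∫ x in symmDiff s t, |h x| := by
  have h1 := integral_inter_add_sdiff ht hi
  have h2 := integral_inter_add_sdiff hs hi'
  rw [inter_comm] at h2
  have hst : IntegrableOn h (s \ t) := hi.mono_set sdiff_subset
  have hts : IntegrableOn h (t \ s) := hi'.mono_set sdiff_subset
  have h3 : ∫ x in symmDiff s t, |h x| = (∫ x in s \ t, |h x|) + ∫ x in t \ s, |h x| :=
    setIntegral_union (disjoint_sdiff_sdiff) (ht.diff hs) hst.abs hts.abs
  have h4 : ∫ x in s \ t, h x ≤ ∫ x in s \ t, |h x| :=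
    integral_mono hst hst.abs fun x => le_abs_self _
  have h5 : ∫ x in t \ s, -h x ≤ ∫ x in t \ s, |h x| :=
    integral_mono hts.neg hts.abs fun x => neg_le_abs _
  rw [integral_neg] at h5
  linarith

section CompositeInequality

variable {X Y : Type*} [NormedAddCommGroup X] [NormedSpace ℝ X] [NormedAddCommGroup Y]
  [NormedSpace ℝ Y]

/-- `u` solves the variational inequality on `K` with form `a`, convex part `N ∘ p` and right-hand
side `ℓ ∘ p`. -/
def SolvesVI (K : Submodule ℝ X) (a : X → X → ℝ) (p : X →L[ℝ] Y) (ℓ : Y →L[ℝ] ℝ) (N : Y → ℝ)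
    (u : X) : Prop :=
  u ∈ K ∧ ∀ v ∈ K, ℓ (p (v - u)) ≤ a u (v - u) + N (p v) - N (p u)

/-- The linear term is absorbed into the convex part, which remains bounded below by a multiple of
the norm since `N` is nonnegative. -/
theorem exists_solvesVI [CompleteSpace X] {K : Submodule ℝ X}
    (hK : IsClosed (K : Set X)) {a : X → X → ℝ} (ha : IsCoerciveSymmForm a) (p : X →L[ℝ] Y)
    (ℓ : Y →L[ℝ] ℝ) {N : Y → ℝ} (hN : ConvexOn ℝ univ N) (hNc : Continuous N)
    (hN0 : ∀ y, 0 ≤ N y) : ∃ u, SolvesVI K a p ℓ N u := by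
  have h1 : ConvexOn ℝ univ fun v => N (p v) - ℓ (p v) := by
    refine ⟨convex_univ, fun v _ w _ s t hs ht hst => ?_⟩
    have := hN.2 (mem_univ (p v)) (mem_univ (p w)) hs ht hst
    simp only [map_add, map_smul, smul_eq_mul] at this ⊢
    linarith
  have h2 : ∀ v, -(‖ℓ.comp p‖ * ‖v‖) ≤ N (p v) - ℓ (p v) := fun v => by
    have h1 := (le_abs_self _).trans ((ℓ.comp p).le_opNorm v)
    have h2 := hN0 (p v)
    rw [ContinuousLinearMap.comp_apply] at h1
    linarith
  obtain ⟨u, hu, h⟩ := exists_variationalInequality hK ha h1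
    ((hNc.comp p.continuous).sub (ℓ.comp p).continuous) h2
  refine ⟨u, hu, fun v hv => ?_⟩
  have := h v hv
  rw [map_sub, map_sub]
  linarith

/-- Each inequality is tested with the other solution and the two are added; `ℓ` cancels, and
coercivity leaves a square on the left. The constant is fixed before `N` and `N'`, hence uniform
over shapes; `m = 0` gives uniqueness. -/
theorem SolvesVI.exists_norm_sub_le (K : Submodule ℝ X) {a : X → X → ℝ}
    (ha : IsCoerciveSymmForm a) (p : X →L[ℝ] Y) (hp : ∀ u, ‖p u‖ ≤ ‖u‖) (ℓ : Y →L[ℝ] ℝ) :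
    ∃ c > 0, ∀ (N N' : Y → ℝ) (m : ℝ), 0 ≤ m →
      (∀ y y', N y' - N y - (N' y' - N' y) ≤ m * ‖y' - y‖) →
      ∀ u u', SolvesVI K a p ℓ N u → SolvesVI K a p ℓ N' u' → c * ‖u - u'‖ ≤ m := by
  obtain ⟨c, hc, h⟩ := ha.exists_sub_le
  refine ⟨c, hc, fun N N' m hm hN u u' hu hu' => ?_⟩
  have h1 := h u u'
  have h2 := hu.2 u' hu'.1
  have h3 := hu'.2 u hu.1
  have h4 := hN (p u) (p u')
  have h5 := mul_le_mul_of_nonneg_left (hp (u' - u)) hm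
  rw [norm_sub_rev u' u] at h5
  rw [← map_sub] at h4
  have h6 : ℓ (p (u - u')) = -ℓ (p (u' - u)) := by rw [← map_neg, ← map_neg, neg_sub]
  rcases (norm_nonneg (u - u')).eq_or_lt with h0 | h0
  · rwa [← h0, mul_zero]
  · refine le_of_mul_le_mul_right ?_ h0
    linarith

theorem SolvesVI.unique {K : Submodule ℝ X} {a : X → X → ℝ} (ha : IsCoerciveSymmForm a)
    {p : X →L[ℝ] Y} (hp : ∀ u, ‖p u‖ ≤ ‖u‖) {ℓ : Y →L[ℝ] ℝ} {N : Y → ℝ} {u u' : X}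
    (hu : SolvesVI K a p ℓ N u) (hu' : SolvesVI K a p ℓ N u') : u = u' := by
  obtain ⟨c, hc, h⟩ := SolvesVI.exists_norm_sub_le K ha p hp ℓ
  have h1 := h N N 0 le_rfl (fun y y' => by simp) u u' hu hu'
  exact sub_eq_zero.1 (norm_le_zero_iff.1 (nonpos_of_mul_nonpos_right h1 hc))

end CompositeInequality

/-! ### The nonsmooth functional -/

theorem setIntegral_abs_norm_sub_norm_le {Ω D : Set E3} (hD : D ⊆ Ω) (hfin : volume D ≠ ∞)
    (v w : L2 Ω) : ∫ x in D, |‖v x‖ - ‖w x‖| ≤ ‖v - w‖ * Real.sqrt (volume.real D) := by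
  refine le_trans (integral_mono_ae ?_ (integrableOn_norm hD hfin (v - w)) ?_)
    (setIntegral_norm_le hD hfin (v - w))
  · exact ((integrableOn_norm hD hfin v).sub (integrableOn_norm hD hfin w)).abs
  · filter_upwards [ae_mono (Measure.restrict_mono hD le_rfl) (Lp.coeFn_sub v w)] with x hx
    rw [hx]
    exact abs_norm_sub_norm_le _ _

theorem continuous_setIntegral_norm {Ω D : Set E3} (hD : D ⊆ Ω) (hfin : volume D ≠ ∞) :
    Continuous fun v : L2 Ω => ∫ x in D, ‖v x‖ := by
  refine (LipschitzWith.of_le_add_mul (Real.sqrt (volume.real D)).toNNReal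
    fun v w => ?_).continuous
  have h1 := setIntegral_abs_norm_sub_norm_le hD hfin v w
  have hv := integrableOn_norm hD hfin v
  have hw := integrableOn_norm hD hfin w
  have h2 : ∫ x in D, (‖v x‖ - ‖w x‖) ≤ ∫ x in D, |‖v x‖ - ‖w x‖| :=
    integral_mono (hv.sub hw) (hv.sub hw).abs fun x => le_abs_self _
  rw [integral_sub hv hw] at h2
  rw [dist_eq_norm, Real.coe_toNNReal _ (Real.sqrt_nonneg _), mul_comm]
  linarith

theorem convexOn_setIntegral_norm {Ω D : Set E3} (hD : D ⊆ Ω) (hfin : volume D ≠ ∞) :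
    ConvexOn ℝ univ fun v : L2 Ω => ∫ x in D, ‖v x‖ := by
  refine ⟨convex_univ, fun v _ w _ s t hs ht _ => ?_⟩
  have hv := (integrableOn_norm hD hfin v).const_mul s
  have hw := (integrableOn_norm hD hfin w).const_mul t
  rw [smul_eq_mul, smul_eq_mul, ← integral_const_mul, ← integral_const_mul, ← integral_add hv hw]
  refine integral_mono_ae (integrableOn_norm hD hfin _) (hv.add hw) ?_
  have hm := Measure.restrict_mono (μ := volume) hD le_rfl
  filter_upwards [ae_mono hm (Lp.coeFn_add (s • v) (t • w)), ae_mono hm (Lp.coeFn_smul s v),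
    ae_mono hm (Lp.coeFn_smul t w)] with x h1 h2 h3
  rw [h1, Pi.add_apply, h2, h3, Pi.smul_apply, Pi.smul_apply]
  refine (norm_add_le _ _).trans_eq ?_
  rw [norm_smul, norm_smul, Real.norm_of_nonneg hs, Real.norm_of_nonneg ht]

theorem setIntegral_inner_eq {Ω : Set E3} {f : E3 → E3} (hf : MemLp f 2 (volume.restrict Ω))
    (v : L2 Ω) : ∫ x in Ω, inner ℝ (f x) (v x) = inner ℝ hf.toLp v := by
  rw [L2.inner_def]
  refine integral_congr_ae ?_
  filter_upwards [hf.coeFn_toLp] with x hx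
  rw [hx]

/-! ### Solvability and stability of the variational inequality -/

theorem isVISolution_iff_solvesVI {Ω s : Set E3} {ν ε : E3 → Matrix (Fin 3) (Fin 3) ℝ} {jc : ℝ}
    {f : E3 → E3} (hf : MemLp f 2 (volume.restrict Ω)) {e : HCurl Ω} :
    IsVISolution ν ε jc f s e ↔ SolvesVI (H0Curl Ω) (curlForm ν ε) (vecFieldCLM Ω)
      (innerSL ℝ hf.toLp) (fun v => jc * ∫ x in s, ‖v x‖) e := by
  unfold IsVISolution
  simp only [setIntegral_inner_eq hf]
  rfl

theorem exists_isVISolution {Ω B s : Set E3} {ν ε : E3 → Matrix (Fin 3) (Fin 3) ℝ}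
    (hν : IsMaterialParameter Ω B ν) (hε : IsMaterialParameter Ω B ε) {jc : ℝ} (hjc : 0 ≤ jc)
    {f : E3 → E3} (hf : MemLp f 2 (volume.restrict Ω)) (hs : s ⊆ Ω) (hfin : volume s ≠ ∞) :
    ∃ e : HCurl Ω, IsVISolution ν ε jc f s e := by
  obtain ⟨u, hu⟩ := exists_solvesVI (K := H0Curl Ω)
    (testFields Ω).isClosed_topologicalClosure (isCoerciveSymmForm_curlForm hν hε) (vecFieldCLM Ω)
    (innerSL ℝ hf.toLp)
    (N := fun v => jc * ∫ x in s, ‖v x‖) ((convexOn_setIntegral_norm hs hfin).smul hjc)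
    (continuous_const.mul (continuous_setIntegral_norm hs hfin))
    (fun v => mul_nonneg hjc (integral_nonneg fun x => norm_nonneg _))
  exact ⟨u, (isVISolution_iff_solvesVI hf).2 hu⟩

theorem setIntegral_norm_sub_sub_le {Ω s t : Set E3} (hΩ : volume Ω ≠ ∞) (hs : s ⊆ Ω) (ht : t ⊆ Ω)
    (hsm : MeasurableSet s) (htm : MeasurableSet t) (v w : L2 Ω) :
    ((∫ x in s, ‖w x‖) - ∫ x in s, ‖v x‖) - ((∫ x in t, ‖w x‖) - ∫ x in t, ‖v x‖) ≤
      ‖w - v‖ * Real.sqrt (volume.real (symmDiff s t)) := by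
  have hD : symmDiff s t ⊆ Ω := fun x hx => hx.elim (fun h => hs h.1) fun h => ht h.1
  have hi := fun {D : Set E3} (hD : D ⊆ Ω) =>
    integrableOn_norm hD (measure_ne_top_of_subset hD hΩ)
  rw [← integral_sub (hi hs w) (hi hs v), ← integral_sub (hi ht w) (hi ht v)]
  exact (setIntegral_sub_setIntegral_le hsm htm ((hi hs w).sub (hi hs v))
    ((hi ht w).sub (hi ht v))).trans
    (setIntegral_abs_norm_sub_norm_le hD (measure_ne_top_of_subset hD hΩ) w v)

theorem exists_isVISolution_norm_sub_le {Ω B : Set E3} (hΩ : volume Ω ≠ ∞)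
    {ν ε : E3 → Matrix (Fin 3) (Fin 3) ℝ}
    (hν : IsMaterialParameter Ω B ν) (hε : IsMaterialParameter Ω B ε) {jc : ℝ} (hjc : 0 ≤ jc)
    {f : E3 → E3} (hf : MemLp f 2 (volume.restrict Ω)) :
    ∃ c > 0, ∀ s t : Set E3, s ⊆ Ω → t ⊆ Ω → MeasurableSet s → MeasurableSet t →
      ∀ e e' : HCurl Ω, IsVISolution ν ε jc f s e → IsVISolution ν ε jc f t e' →
        c * ‖e - e'‖ ≤ jc * Real.sqrt (volume.real (symmDiff s t)) := by
  obtain ⟨c, hc, h⟩ := SolvesVI.exists_norm_sub_le (H0Curl Ω) (isCoerciveSymmForm_curlForm hν hε)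
    (vecFieldCLM Ω) norm_vecField_le (innerSL ℝ hf.toLp)
  refine ⟨c, hc, fun s t hs ht hsm htm e e' he he' => h _ _ _ (by positivity) (fun v w => ?_) e e'
    ((isVISolution_iff_solvesVI hf).1 he) ((isVISolution_iff_solvesVI hf).1 he')⟩
  have := mul_le_mul_of_nonneg_left (setIntegral_norm_sub_sub_le hΩ hs ht hsm htm v w) hjc
  linarith

theorem existsUnique_isVISolution {Ω B s : Set E3} {ν ε : E3 → Matrix (Fin 3) (Fin 3) ℝ}
    (hν : IsMaterialParameter Ω B ν) (hε : IsMaterialParameter Ω B ε) {jc : ℝ} (hjc : 0 ≤ jc)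
    {f : E3 → E3} (hf : MemLp f 2 (volume.restrict Ω)) (hs : s ⊆ Ω) (hfin : volume s ≠ ∞) :
    ∃! e : HCurl Ω, IsVISolution ν ε jc f s e :=
  existsUnique_of_exists_of_unique (exists_isVISolution hν hε hjc hf hs hfin) fun _ _ he he' =>
    SolvesVI.unique (isCoerciveSymmForm_curlForm hν hε) norm_vecField_le
      ((isVISolution_iff_solvesVI hf).1 he) ((isVISolution_iff_solvesVI hf).1 he')

theorem electricField_spec {Ω : Set E3} {ν ε : E3 → Matrix (Fin 3) (Fin 3) ℝ} {jc : ℝ}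
    {f : E3 → E3} {s : Set E3} (h : ∃ e : HCurl Ω, IsVISolution ν ε jc f s e) :
    IsVISolution ν ε jc f s (electricField Ω ν ε jc f s) :=
  Classical.epsilon_spec h

theorem tendsto_vecField_electricField {Ω B : Set E3} (hΩ : volume Ω ≠ ∞)
    {ν ε : E3 → Matrix (Fin 3) (Fin 3) ℝ}
    (hν : IsMaterialParameter Ω B ν) (hε : IsMaterialParameter Ω B ε) {jc : ℝ} (hjc : 0 ≤ jc)
    {f : E3 → E3} (hf : MemLp f 2 (volume.restrict Ω)) {ι : Type*} {l : Filter ι}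
    {s : ι → Set E3} {t : Set E3} (hs : ∀ i, s i ⊆ Ω) (ht : t ⊆ Ω)
    (hsm : ∀ i, MeasurableSet (s i)) (htm : MeasurableSet t)
    (h : Tendsto (fun i => volume.real (symmDiff (s i) t)) l (𝓝 0)) :
    Tendsto (fun i => vecField (electricField Ω ν ε jc f (s i))) l
      (𝓝 (vecField (electricField Ω ν ε jc f t))) := by
  obtain ⟨c, hc, hle⟩ := exists_isVISolution_norm_sub_le hΩ hν hε hjc hf
  have hspec : ∀ {r : Set E3}, r ⊆ Ω → IsVISolution ν ε jc f r (electricField Ω ν ε jc f r) :=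
    fun hr => electricField_spec
      (exists_isVISolution hν hε hjc hf hr (measure_ne_top_of_subset hr hΩ))
  refine tendsto_iff_norm_sub_tendsto_zero.2 ?_
  have h0 : Tendsto (fun i => jc * Real.sqrt (volume.real (symmDiff (s i) t)) / c) l (𝓝 0) := by
    simpa using (h.sqrt.const_mul jc).div_const c
  refine squeeze_zero (fun _ => norm_nonneg _) (fun i => ?_) h0
  rw [le_div_iff₀' hc]
  exact (mul_le_mul_of_nonneg_left (norm_vecField_le (_ - _)) hc.le).trans
    (hle _ _ (hs i) ht (hsm i) htm _ _ (hspec (hs i)) (hspec ht))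

/-! ### The tracking functional -/

/-- The integral is a bounded quadratic form on `L²(B)` evaluated at the restriction of `v` minus
`Ed`. -/
theorem continuous_tracking {Ω B : Set E3} (hB : IsOpen B) (hBΩ : B ⊆ Ω)
    (hΩ : volume Ω ≠ ∞) {κ : E3 → ℝ} (hκ : MemC1 B κ) {Ed : E3 → E3} (hEd : MemC1 B Ed) :
    Continuous fun v : L2 Ω => ∫ x in B, κ x * ‖v x - Ed x‖ ^ 2 := by
  obtain ⟨hκc, C, hC⟩ := hκ
  obtain ⟨hEc, C', hC'⟩ := hEd
  have hBm := hB.measurableSet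
  have hEfin : IsFiniteMeasure (volume.restrict B) :=
    isFiniteMeasure_restrict.2 (measure_ne_top_of_subset hBΩ hΩ)
  have hκm : MemLp κ ∞ (volume.restrict B) :=
    memLp_top_of_bound (hκc.continuousOn.aestronglyMeasurable hBm) C
      ((ae_restrict_mem hBm).mono fun x hx => (hC x hx).1)
  have hEm : MemLp Ed 2 (volume.restrict B) :=
    MemLp.of_bound (hEc.continuousOn.aestronglyMeasurable hBm) C'
      ((ae_restrict_mem hBm).mono fun x hx => (hC' x hx).1)
  have hT : MemLp (fun x => κ x • ContinuousLinearMap.id ℝ E3) ∞ (volume.restrict B) :=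
    ((ContinuousLinearMap.id ℝ ℝ).smulRight (ContinuousLinearMap.id ℝ E3)).comp_memLp' hκm
  obtain ⟨b, hb⟩ := exists_coefficientForm hT
  have hmono : volume.restrict B ≤ volume.restrict Ω := Measure.restrict_mono hBΩ le_rfl
  let ρ : L2 Ω → Lp E3 2 (volume.restrict B) := fun v =>
    (memLp_restrict_of_subset hBΩ v).toLp
  have hρ : Continuous ρ := by
    refine (LipschitzWith.of_dist_le_mul (K := 1) fun v w => ?_).continuous
    rw [NNReal.coe_one, one_mul, dist_eq_norm, dist_eq_norm, Lp.norm_def, Lp.norm_def]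
    refine ENNReal.toReal_mono (Lp.eLpNorm_ne_top _) ?_
    refine le_trans (le_of_eq (eLpNorm_congr_ae ?_)) (eLpNorm_mono_measure _ hmono)
    filter_upwards [Lp.coeFn_sub (ρ v) (ρ w), (memLp_restrict_of_subset hBΩ v).coeFn_toLp,
      (memLp_restrict_of_subset hBΩ w).coeFn_toLp, ae_mono hmono (Lp.coeFn_sub v w)]
      with x h1 h2 h3 h4
    rw [h1, h4, Pi.sub_apply, Pi.sub_apply, h2, h3]
  have hq : Continuous fun v : L2 Ω => b (ρ v - hEm.toLp) (ρ v - hEm.toLp) := by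
    have : Continuous fun v : L2 Ω => ρ v - hEm.toLp := hρ.sub continuous_const
    exact (b.continuous.comp this).clm_apply this
  refine hq.congr fun v => ?_
  rw [(hb _ _).2]
  refine integral_congr_ae ?_
  filter_upwards [Lp.coeFn_sub (ρ v) hEm.toLp, (memLp_restrict_of_subset hBΩ v).coeFn_toLp,
    hEm.coeFn_toLp] with x h1 h2 h3
  rw [h1, Pi.sub_apply, h2, h3, smul_apply, ContinuousLinearMap.id_apply,
    real_inner_smul_left, real_inner_self_eq_norm_sq]

theorem tendsto_volume_real {ι : Type*} {l : Filter ι} {s : ι → Set E3} {t : Set E3}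
    (hs : ∀ i, MeasurableSet (s i)) (hsfin : ∀ i, volume (s i) ≠ ∞) (ht : MeasurableSet t)
    (htfin : volume t ≠ ∞) (h : Tendsto (fun i => volume.real (symmDiff (s i) t)) l (𝓝 0)) :
    Tendsto (fun i => volume.real (s i)) l (𝓝 (volume.real t)) := by
  refine tendsto_iff_dist_tendsto_zero.2 (squeeze_zero (fun _ => dist_nonneg) (fun i => ?_) h)
  rw [Real.dist_eq]
  exact abs_measureReal_sub_le_measureReal_symmDiff' (hs i).nullMeasurableSet ht.nullMeasurableSet
    (hsfin i) htfin

end ShapeOpt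

/-! ### Existence of an optimal shape -/

open Filter Topology Metric Set

theorem theorem2p2
    (Ω B : Set E3) (hΩ : IsLipschitzDomain Ω) (hΩb : Bornology.IsBounded Ω)
    (hB : IsLipschitzDomain B) (hBΩ : B ⊆ Ω)
    (L : ℝ≥0) (δ : ℝ) (hδ : 0 < δ)
    (Ed : E3 → E3) (hEd : MemC1 B Ed)
    (κ : E3 → ℝ) (hκ : MemC1 B κ) (hκpos : ∀ x ∈ B, 0 < κ x)
    (jc : ℝ) (hjc : 0 < jc)
    (ν ε : E3 → Matrix (Fin 3) (Fin 3) ℝ)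
    (hν : IsMaterialParameter Ω B ν) (hε : IsMaterialParameter Ω B ε)
    (f : E3 → E3) (hf : MemLp f 2 (volume.restrict Ω)) (hfB : MemC1 B f) :
    (∀ s ∈ admissibleShapes B L δ, ∃! e : HCurl Ω, IsVISolution ν ε jc f s e) ∧
    ∃ s_opt ∈ admissibleShapes B L δ, ∀ s ∈ admissibleShapes B L δ,
      cost Ω B ν ε jc f κ Ed s_opt ≤ cost Ω B ν ε jc f κ Ed s := by
  have hΩfin : volume Ω ≠ ∞ := hΩb.measure_lt_top.ne
  have hsub : ∀ {s}, s ∈ admissibleShapes B L δ → s ⊆ Ω := fun hs => hs.1.trans hBΩ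
  have hmeas : ∀ {s}, s ∈ admissibleShapes B L δ → MeasurableSet s := fun hs => hs.2.1.measurableSet
  have hfin : ∀ {s}, s ∈ admissibleShapes B L δ → volume s ≠ ∞ := fun hs =>
    measure_ne_top_of_subset (hsub hs) hΩfin
  refine ⟨fun s hs => existsUnique_isVISolution hν hε hjc.le hf (hsub hs) (hfin hs), ?_⟩
  set J := cost Ω B ν ε jc f κ Ed with hJ
  have hne : (J '' admissibleShapes B L δ).Nonempty :=
    -- The empty shape is admissible because its boundary is empty.
    ⟨_, ∅, ⟨empty_subset _, isOpen_empty, by simp⟩, rfl⟩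
  have hbdd : BddBelow (J '' admissibleShapes B L δ) := by
    refine ⟨0, ?_⟩
    rintro _ ⟨s, -, rfl⟩
    refine add_nonneg (mul_nonneg (by norm_num) ?_) (integral_nonneg fun _ => zero_le_one)
    exact setIntegral_nonneg hB.isOpen.measurableSet fun x hx =>
      mul_nonneg (hκpos x hx).le (sq_nonneg _)
  obtain ⟨y, -, hy, hyJ⟩ := exists_seq_tendsto_sInf hne hbdd
  choose s hs hsy using hyJ
  -- Finer than `atTop`, so the costs still tend to the infimum along `U`.
  let U : Ultrafilter ℕ := Ultrafilter.of atTop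
  set t := interiorLimit (U : Filter ℕ) s
  have ht : t ∈ admissibleShapes B L δ := interiorLimit_mem_admissibleShapes U hδ hs
  have hvol : Tendsto (fun n => volume.real (symmDiff (s n) t)) U (𝓝 0) :=
    (ENNReal.tendsto_toReal ENNReal.zero_ne_top).comp
      (tendsto_volume_symmDiff_interiorLimit U (hΩb.subset hBΩ) hδ hs)
  have hE := tendsto_vecField_electricField hΩfin hν hε hjc.le hf (fun n => hsub (hs n)) (hsub ht)
    (fun n => hmeas (hs n)) (hmeas ht) hvol
  have hJt : Tendsto (fun n => J (s n)) U (𝓝 (J t)) := by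
    simp only [hJ, cost, setIntegral_const, smul_eq_mul, mul_one]
    exact ((((continuous_tracking hB.isOpen hBΩ hΩfin hκ hEd).tendsto _).comp hE).const_mul
      _).add (tendsto_volume_real (fun n => hmeas (hs n)) (fun n => hfin (hs n)) (hmeas ht)
        (hfin ht) hvol)
  have hlim : Tendsto (fun n => J (s n)) U (𝓝 (sInf (J '' admissibleShapes B L δ))) := by
    simpa only [hsy] using hy.mono_left (Ultrafilter.of_le atTop)
  refine ⟨t, ht, fun r hr => ?_⟩
  rw [tendsto_nhds_unique hJt hlim]
  exact csInf_le hbdd ⟨r, hr, rfl⟩
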